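/- Let $d\ge 1$ be an integer, $\Omega\subset\mathbb{R}^d$ a root system (a finite set of nonzero vectors with $\Omega\cap\mathbb{R}\alpha=\{\pm\alpha\}$ and $\sigma_\alpha\Omega=\Omega$ for all $\alpha\in\Omega$, where $\sigma_\alpha$ is the reflection in the hyperplane $\alpha^\perp$), $\kappa\colon\Omega\to[0,\infty)$ a function invariant under the group generated by the $\sigma_\alpha$, and $\langle\kappa\rangle=\frac12\sum_{\alpha\in\Omega}\kappa(\alpha)$. Let $R\ge 2$ be an integer, $a=\frac2R$, $\eta=\langle\kappa\rangle+\frac{d-2}{2}$, and assume $\eta>0$. Let $\tau\in[-1,1]$ and $q=\arccos\tau$. For $w>0$ put $$\Psi_a^d(w,\tau)=2^{2\eta/a}\,\Gamma\Bigl(\frac{2\eta+a}{a}\Bigr)\sum_{j=0}^{\infty}e^{-\frac{i\pi j}{a}}\,\frac{\eta+j}{\eta}\,w^{-2\eta/a}J_{\frac{2(\eta+j)}{a}}(w)\,C_j^{\eta}(\tau),$$ and $\Psi_a^d(0,\tau)=1$, where $J_\nu$ is the Bessel function of the first kind and $C_j^\eta$ is the Gegenbauer polynomial. Then the series converges absolutely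 for every $w>0$, and the function $w\mapsto\Psi_a^d(w,\tau)$ extends from $[0,\infty)$ to an entire function $F$ of $w\in\mathbb{C}$ such that: 1. the restriction of $F$ to $\mathbb{R}$ is positive definite, i.e. it is continuous and $\sum_{s,l=1}^n z_s\overline{z_l}F(v_s-v_l)\ge 0$ for all $n$, all $v_1,\dots,v_n\in\mathbb{R}$ and all $z_1,\dots,z_n\in\mathbb{C}$; 2. $F$ is of exponential type exactly $\theta(a,\tau)$, i.e. $\theta(a,\tau)$ is the least $s\ge 0$ such that for every $\varepsilon>0$ there is a constant $C$ with $|F(z)|\le C e^{(s+\varepsilon)|z|}$ for all $z\in\mathbb{C}$, where $$\theta(a,\tau)=\begin{cases}\cos\frac qR, & R \text{ even, or } R \text{ odd and } 0\le q\le\frac\pi2,\\[2pt] \cos\frac{\pi-q}{R}, & R\text{ odd and } \frac\pi2\le q\le\pi.\end{cases}$$ -/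

import Mathlib

open scoped ComplexOrder

noncomputable section

/-- The orthogonal reflection of `ℝ^d` in the hyperplane `⟨α, x⟩ = 0`. -/
def hyperplaneReflection {d : ℕ} (α : EuclideanSpace ℝ (Fin d)) :
    EuclideanSpace ℝ (Fin d) ≃ₗᵢ[ℝ] EuclideanSpace ℝ (Fin d) :=
  Submodule.reflection (Submodule.span ℝ {α})ᗮ

/-- A (reduced, not necessarily crystallographic or spanning, possibly empty) root system in
`ℝ^d`, as in Dunkl theory: a finite set of nonzero vectors, with `Ω ∩ ℝ α = {α, -α}` for every
root `α`, which is stable under the reflections in its roots. -/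
structure IsDunklRootSystem {d : ℕ} (Ω : Finset (EuclideanSpace ℝ (Fin d))) : Prop where
  zero_notMem : (0 : EuclideanSpace ℝ (Fin d)) ∉ Ω
  inter_line : ∀ α ∈ Ω,
    (Ω : Set (EuclideanSpace ℝ (Fin d))) ∩ (Submodule.span ℝ {α} : Set _) = {α, -α}
  reflection_mem : ∀ α ∈ Ω, ∀ β ∈ Ω, hyperplaneReflection α β ∈ Ω

/-- The reflection group `G ⊂ O(d)` generated by the reflections in the roots. -/
def reflectionGroup {d : ℕ} (Ω : Finset (EuclideanSpace ℝ (Fin d))) :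
    Subgroup (EuclideanSpace ℝ (Fin d) ≃ₗᵢ[ℝ] EuclideanSpace ℝ (Fin d)) :=
  Subgroup.closure (hyperplaneReflection '' (Ω : Set (EuclideanSpace ℝ (Fin d))))

/-- A multiplicity function on `Ω`: nonnegative and `G`-invariant (only the values on `Ω`
matter). -/
structure IsMultiplicityFunction {d : ℕ} (Ω : Finset (EuclideanSpace ℝ (Fin d)))
    (κ : EuclideanSpace ℝ (Fin d) → ℝ) : Prop where
  nonneg : ∀ α ∈ Ω, 0 ≤ κ α
  invariant : ∀ g ∈ reflectionGroup Ω, ∀ α ∈ Ω, κ (g α) = κ α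

/-- `⟨κ⟩ = (1/2) ∑_{α ∈ Ω} κ(α)`. -/
def kappaBracket {d : ℕ} (Ω : Finset (EuclideanSpace ℝ (Fin d)))
    (κ : EuclideanSpace ℝ (Fin d) → ℝ) : ℝ :=
  (1 / 2) * ∑ α ∈ Ω, κ α

/-- The Bessel function of the first kind `J_ν(x)`, for `ν ≥ 0` and `x > 0`. -/
def besselJ (ν x : ℝ) : ℝ :=
  ∑' k : ℕ, (-1) ^ k / ((k.factorial : ℝ) * Real.Gamma (k + ν + 1)) *
    (x / 2) ^ (2 * (k : ℝ) + ν)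

/-- The Gegenbauer polynomial
`C_j^η(t) = ∑_{k ≤ j/2} (-1)^k (η)_{j-k} / (k! (j-2k)!) (2t)^{j-2k}`. -/
def gegenbauerC (η : ℝ) (j : ℕ) (t : ℝ) : ℝ :=
  ∑ k ∈ Finset.range (j / 2 + 1),
    (-1) ^ k * (ascPochhammer ℝ (j - k)).eval η /
      ((k.factorial : ℝ) * ((j - 2 * k).factorial : ℝ)) * (2 * t) ^ (j - 2 * k)

/-- The `j`-th term of the series defining `Ψ_a^d(w, τ)`, for `w > 0`:
`e^{-iπj/a} ((η + j)/η) w^{-2η/a} J_{2(η+j)/a}(w) C_j^η(τ)`. -/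
def psiTerm (a η w τ : ℝ) (j : ℕ) : ℂ :=
  Complex.exp (-(Complex.I * Real.pi * j / a)) *
    (((η + j) / η * w ^ (-(2 * η / a)) * besselJ (2 * (η + j) / a) w * gegenbauerC η j τ : ℝ) : ℂ)

/-- `Ψ_a^d(w, τ)` for `w ≥ 0`, where `η = ⟨κ⟩ + (d - 2)/2`; the value at `w = 0`, where
`w^{-2η/a}` has to be read as a limit, is `1`. -/
def Psi (a η w τ : ℝ) : ℂ :=
  if w = 0 then 1
  else ((2 ^ (2 * η / a) * Real.Gamma ((2 * η + a) / a) : ℝ) : ℂ) * ∑' j : ℕ, psiTerm a η w τ j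

/-- Positive definite functions on `ℝ`. In the order of `ℂ`, `0 ≤ z` means that `z` is real and
nonnegative. -/
def IsPositiveDefiniteFun (f : ℝ → ℂ) : Prop :=
  Continuous f ∧ ∀ (n : ℕ) (v : Fin n → ℝ) (z : Fin n → ℂ),
    0 ≤ ∑ s, ∑ l, z s * (starRingEnd ℂ) (z l) * f (v s - v l)

/-- `f` is an entire function of exponential type exactly `σ`: `σ` is the least `s ≥ 0` such that
`|f(z)| ≤ C_ε e^{(s+ε)|z|}` on `ℂ` for every `ε > 0`. -/
def IsEntireOfExponentialType (f : ℂ → ℂ) (σ : ℝ) : Prop :=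
  Differentiable ℂ f ∧
    IsLeast {s : ℝ | 0 ≤ s ∧ ∀ ε : ℝ, 0 < ε → ∃ C : ℝ, ∀ z : ℂ,
      ‖f z‖ ≤ C * Real.exp ((s + ε) * ‖z‖)} σ

open Classical in
/-- `θ(a, τ)` for `a = 2/R`, with `q = arccos τ`. -/
def thetaType (R : ℕ) (τ : ℝ) : ℝ :=
  if Odd R ∧ Real.pi / 2 ≤ Real.arccos τ then Real.cos ((Real.pi - Real.arccos τ) / R)
  else Real.cos (Real.arccos τ / R)

end

/-! F is the Fourier transform of a compactly supported probability measure: the law μ of ∑ c_l X_l,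
where c_l = cos((q + 2πl)/R) for l < R and X has the symmetric Dirichlet distribution of parameter
η. Positive definiteness is then immediate, and the exponential type is the largest |x| in the
support of μ, which is max |c_l| = θ.

That F continues Ψ is a comparison of power series in -iw. The n-th moment of μ is n!/(Rη)_n times
the coefficient of z^n in ∏ (1 - c_l z)^(-η) (`exists_dirichlet_law`). For z = 2v/(1 + v²) this
product becomes (1 + v²)^(Rη) (1 - 2τ v^R + v^(2R))^(-η), because the e^{i(q+2πl)/R} are the R-th
roots of e^{iq} (`prod_one_sub_cos`). The Gegenbauer generating function turns it into ∑_j C_j^η(τ)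
(z/2)^(Rj) (1 + v²)^(R(η+j)), and 1 + v² is the Catalan generating function at z²/4, so its powers
expand explicitly in z (`hasSum_catalanCoeff`). The coefficient of z^n is thus a sum over Rj + 2k =
n (`dirichletCoeff_eq_tsum`); divided by (Rη)_n, its terms are those of the Bessel expansion of Ψ
(`Psi_const_mul_psiTerm`). -/

noncomputable section

/-! ### Rising factorials and the binomial series -/

/-- The coefficient `(s)_n / n!` of `x ^ n` in `(1 - x) ^ (-s)`. -/
def risingCoeff (s : ℝ) (n : ℕ) : ℝ := (ascPochhammer ℝ n).eval s / n.factorial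

@[simp] lemma risingCoeff_zero (s : ℝ) : risingCoeff s 0 = 1 := by simp [risingCoeff]

lemma risingCoeff_succ (s : ℝ) (n : ℕ) :
    risingCoeff s (n + 1) = risingCoeff s n * ((s + n) / (n + 1)) := by
  simp only [risingCoeff, ascPochhammer_succ_eval, Nat.factorial_succ]
  push_cast
  have : (n.factorial : ℝ) ≠ 0 := by positivity
  field_simp

lemma risingCoeff_nonneg {s : ℝ} (hs : 0 ≤ s) (n : ℕ) : 0 ≤ risingCoeff s n := by
  induction n with
  | zero => simp
  | succ n ih => rw [risingCoeff_succ]; positivity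

lemma risingCoeff_eq_choose (s : ℝ) (n : ℕ) : risingCoeff s n = Ring.choose (s + n - 1) n := by
  have h := Ring.factorial_nsmul_multichoose_eq_ascPochhammer s n
  rw [Ring.choose, show s + n - 1 - n + 1 = s by ring, risingCoeff,
    div_eq_iff (by positivity), mul_comm, ← nsmul_eq_mul, h]
  rw [Polynomial.ascPochhammer_smeval_eq_eval]

lemma hasSum_risingCoeff (s : ℝ) {x : ℝ} (hx : |x| < 1) :
    HasSum (fun n => risingCoeff s n * x ^ n) ((1 - x) ^ (-s)) := by
  have h := (Real.one_div_one_sub_rpow_hasFPowerSeriesOnBall_zero s).hasSum (y := x)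
    (by simpa [enorm_eq_nnnorm] using! hx)
  have h1 : 0 ≤ 1 - x := by linarith [(abs_lt.1 hx).2]
  rw [zero_add, one_div, ← Real.rpow_neg h1] at h
  simp only [FormalMultilinearSeries.ofScalars_apply_eq, smul_eq_mul] at h
  simpa only [risingCoeff_eq_choose] using h

lemma Gamma_add_natCast {s : ℝ} (hs : 0 < s) (n : ℕ) :
    Real.Gamma (s + n) = (ascPochhammer ℝ n).eval s * Real.Gamma s := by
  induction n with
  | zero => simp
  | succ n ih =>
    rw [Nat.cast_succ, ← add_assoc, Real.Gamma_add_one (by positivity), ih,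
      ascPochhammer_succ_eval]
    ring

lemma ascPochhammer_eval_add (s : ℝ) (m n : ℕ) :
    (ascPochhammer ℝ (m + n)).eval s =
      (ascPochhammer ℝ m).eval s * (ascPochhammer ℝ n).eval (s + m) := by
  rw [← ascPochhammer_mul]
  simp

/-! ### The beta distribution -/

section BetaMeasure

open MeasureTheory ProbabilityTheory

lemma integral_betaPDFReal {α β : ℝ} (hα : 0 < α) (hβ : 0 < β) :
    ∫ x, betaPDFReal α β x = 1 := by
  have hn : ∀ x, 0 ≤ betaPDFReal α β x := fun x => by
    by_cases h : 0 < x ∧ x < 1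
    · exact (betaPDFReal_pos h.1 h.2 hα hβ).le
    · rw [betaPDFReal, if_neg h]
  rw [integral_eq_lintegral_of_nonneg_ae (Filter.Eventually.of_forall hn)
    (stronglyMeasurable_betaPDFReal α β).aestronglyMeasurable]
  have := lintegral_betaPDF_eq_one hα hβ
  simp only [betaPDF] at this
  simp [this]

lemma betaPDFReal_nonneg {α β : ℝ} (hα : 0 < α) (hβ : 0 < β) (x : ℝ) :
    0 ≤ betaPDFReal α β x := by
  by_cases h : 0 < x ∧ x < 1
  · exact (betaPDFReal_pos h.1 h.2 hα hβ).le
  · rw [betaPDFReal, if_neg h]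

lemma integral_betaMeasure {α β : ℝ} (hα : 0 < α) (hβ : 0 < β) (f : ℝ → ℝ) :
    ∫ x, f x ∂(betaMeasure α β) = ∫ x, betaPDFReal α β x * f x := by
  rw [betaMeasure, integral_withDensity_eq_integral_toReal_smul]
  · refine integral_congr_ae (Filter.Eventually.of_forall fun x => ?_)
    simp [betaPDF, ENNReal.toReal_ofReal (betaPDFReal_nonneg hα hβ x)]
  · exact (measurable_betaPDFReal α β).ennreal_ofReal
  · exact Filter.Eventually.of_forall fun x => by simp [betaPDF]

/-- The weighted density is a multiple of the Beta(α + i, β + k) density, which has mass 1; the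
moment is a ratio of beta functions. -/
lemma betaMeasure_moment {α β : ℝ} (hα : 0 < α) (hβ : 0 < β) (i k : ℕ) :
    ∫ x, x ^ i * (1 - x) ^ k ∂(betaMeasure α β) =
      (ascPochhammer ℝ i).eval α * (ascPochhammer ℝ k).eval β /
        (ascPochhammer ℝ (i + k)).eval (α + β) := by
  have hi : 0 < α + i := by positivity
  have hk : 0 < β + k := by positivity
  have key : ∀ x, betaPDFReal α β x * (x ^ i * (1 - x) ^ k) =
      beta (α + i) (β + k) / beta α β * betaPDFReal (α + i) (β + k) x := by
    intro x
    by_cases h : 0 < x ∧ x < 1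
    · have h1 : 0 < 1 - x := by linarith [h.2]
      rw [betaPDFReal, betaPDFReal, if_pos h, if_pos h,
        show α + i - 1 = (α - 1) + i by ring, show β + k - 1 = (β - 1) + k by ring,
        Real.rpow_add_natCast h.1.ne', Real.rpow_add_natCast h1.ne']
      have := (beta_pos hα hβ).ne'
      have := (beta_pos hi hk).ne'
      field_simp
    · simp [betaPDFReal, if_neg h]
  rw [integral_betaMeasure hα hβ]
  simp_rw [key]
  rw [integral_const_mul, integral_betaPDFReal hi hk, mul_one, beta, beta,
    show α + i + (β + k) = (α + β) + ((i + k : ℕ) : ℝ) by push_cast; ring,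
    Gamma_add_natCast hα, Gamma_add_natCast hβ, Gamma_add_natCast (add_pos hα hβ)]
  have := (Real.Gamma_pos_of_pos hα).ne'
  have := (Real.Gamma_pos_of_pos hβ).ne'
  have := (Real.Gamma_pos_of_pos (add_pos hα hβ)).ne'
  have := (ascPochhammer_pos (i + k) (α + β) (add_pos hα hβ)).ne'
  field_simp

lemma ae_betaMeasure_mem_Ioo (α β : ℝ) :
    ∀ᵐ x ∂(betaMeasure α β), x ∈ Set.Ioo (0 : ℝ) 1 := by
  change betaMeasure α β (Set.Ioo 0 1)ᶜ = 0
  rw [betaMeasure, withDensity_apply _ measurableSet_Ioo.compl]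
  refine setLIntegral_eq_zero measurableSet_Ioo.compl fun x hx => ?_
  rw [betaPDF_eq, if_neg (by simpa using hx)]
  simp

lemma betaMeasure_Ioo_pos {α β : ℝ} (hα : 0 < α) (hβ : 0 < β) {u v : ℝ} (hu : 0 ≤ u)
    (huv : u < v) (hv : v ≤ 1) : 0 < betaMeasure α β (Set.Ioo u v) := by
  rw [betaMeasure, withDensity_apply _ measurableSet_Ioo, setLIntegral_pos_iff]
  · have : Function.support (betaPDF α β) ∩ Set.Ioo u v = Set.Ioo u v := by
      refine Set.inter_eq_right.2 fun x hx => ?_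
      have := betaPDFReal_pos (hu.trans_lt hx.1) (hx.2.trans_le hv) hα hβ
      simpa [betaPDF] using this
    rw [this]
    simpa using huv
  · exact (measurable_betaPDFReal α β).ennreal_ofReal

end BetaMeasure
end

/-! ### Linear combinations of Dirichlet variables -/

noncomputable section

/-- The coefficient of `z ^ n` in `∏ i < m, (1 - c i * z) ^ (-η)`. -/
def dirichletCoeff (η : ℝ) (c : ℕ → ℝ) : ℕ → ℕ → ℝ
  | 0, n => if n = 0 then 1 else 0
  | m + 1, n => ∑ p ∈ Finset.HasAntidiagonal.antidiagonal n,
      dirichletCoeff η c m p.1 * (risingCoeff η p.2 * c m ^ p.2)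

lemma dirichletCoeff_one (η : ℝ) (c : ℕ → ℝ) (n : ℕ) :
    dirichletCoeff η c 1 n = risingCoeff η n * c 0 ^ n := by
  rw [dirichletCoeff, Finset.sum_eq_single (0, n)]
  · simp [dirichletCoeff]
  · rintro ⟨i, k⟩ h hne
    have : i ≠ 0 := by
      rintro rfl
      simp at h
      exact hne (by rw [h])
    simp [dirichletCoeff, this]
  · simp

open MeasureTheory ProbabilityTheory

lemma integrable_pow_of_ae_abs_le {μ : Measure ℝ} [IsFiniteMeasure μ] {M : ℝ}
    (h : ∀ᵐ x ∂μ, |x| ≤ M) (n : ℕ) : Integrable (fun x => x ^ n) μ := by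
  refine Integrable.of_bound (by fun_prop) (M ^ n) ?_
  filter_upwards [h] with x hx
  rw [Real.norm_eq_abs, abs_pow]
  gcongr

lemma betaMixture_moment {μ ν : Measure ℝ} [IsProbabilityMeasure μ] {α β M c : ℝ}
    (hα : 0 < α) (hβ : 0 < β) (hν : ν = betaMeasure α β) (hM : ∀ᵐ x ∂μ, |x| ≤ M) (n : ℕ) :
    ∫ x, x ^ n ∂((μ.prod ν).map fun p => p.2 * p.1 + (1 - p.2) * c) =
      ∑ p ∈ Finset.HasAntidiagonal.antidiagonal n, n.choose p.1 * (∫ x, x ^ p.1 ∂μ) * c ^ p.2 *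
        ((ascPochhammer ℝ p.1).eval α * (ascPochhammer ℝ p.2).eval β /
          (ascPochhammer ℝ n).eval (α + β)) := by
  have : IsProbabilityMeasure ν := hν ▸ isProbabilityMeasureBeta hα hβ
  rw [integral_map (by fun_prop) (by fun_prop)]
  have e : ∀ p : ℝ × ℝ, (p.2 * p.1 + (1 - p.2) * c) ^ n =
      ∑ q ∈ Finset.HasAntidiagonal.antidiagonal n,
        p.1 ^ q.1 * (n.choose q.1 * c ^ q.2 * (p.2 ^ q.1 * (1 - p.2) ^ q.2)) := by
    intro p
    rw [(Commute.all _ _).add_pow']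
    refine Finset.sum_congr rfl fun q _ => ?_
    rw [nsmul_eq_mul, mul_pow, mul_pow]
    ring
  have hint : ∀ i k : ℕ, Integrable (fun b : ℝ => b ^ i * (1 - b) ^ k) ν := by
    intro i k
    refine Integrable.of_bound (by fun_prop) 1 ?_
    filter_upwards [hν ▸ ae_betaMeasure_mem_Ioo α β] with b hb
    rw [Real.norm_eq_abs, abs_mul, abs_pow, abs_pow]
    refine mul_le_one₀ (pow_le_one₀ (abs_nonneg _) ?_) (by positivity)
      (pow_le_one₀ (abs_nonneg _) ?_)
    · rw [abs_of_pos hb.1]; exact hb.2.le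
    · rw [abs_of_pos (by linarith [hb.2])]; linarith [hb.1]
  simp_rw [e]
  rw [integral_finsetSum]
  · refine Finset.sum_congr rfl fun q hq => ?_
    rw [integral_prod_mul (fun x : ℝ => x ^ q.1)
      (fun b : ℝ => n.choose q.1 * c ^ q.2 * (b ^ q.1 * (1 - b) ^ q.2)),
      integral_const_mul, hν, betaMeasure_moment hα hβ, Finset.HasAntidiagonal.mem_antidiagonal.1 hq]
    ring
  · intro q _
    exact (integrable_pow_of_ae_abs_le hM q.1).mul_prod ((hint q.1 q.2).const_mul _)

/-- The law of `∑ i, c i * X i` for `X` with the symmetric Dirichlet distribution of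
parameter `η`, described by its moments. -/
lemma exists_dirichlet_law {η M : ℝ} (hη : 0 < η) (c : ℕ → ℝ) (hc : ∀ i, |c i| ≤ M) (m : ℕ) :
    ∃ μ : Measure ℝ, IsProbabilityMeasure μ ∧ (∀ᵐ x ∂μ, |x| ≤ M) ∧
      (∀ i ≤ m, ∀ δ > 0, 0 < μ (Metric.ball (c i) δ)) ∧
      ∀ n : ℕ, ∫ x, x ^ n ∂μ =
        n.factorial * dirichletCoeff η c (m + 1) n /
          (ascPochhammer ℝ n).eval (((m + 1 : ℕ) : ℝ) * η) := by
  have hM0 : 0 ≤ M := (abs_nonneg _).trans (hc 0)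
  induction m with
  | zero =>
    refine ⟨Measure.dirac (c 0), inferInstance, ?_, ?_, fun n => ?_⟩
    · rw [ae_dirac_eq]; exact hc 0
    · intro i hi δ hδ
      obtain rfl : i = 0 := by omega
      rw [Measure.dirac_apply_of_mem (Metric.mem_ball_self hδ)]
      exact one_pos
    · rw [integral_dirac, zero_add, dirichletCoeff_one, risingCoeff]
      have := (ascPochhammer_pos n η hη).ne'
      simp only [Nat.cast_one, one_mul]
      field_simp
  | succ m ih =>
    obtain ⟨μ, hμ, hμM, hμb, hμm⟩ := ih
    have hα : 0 < ((m + 1 : ℕ) : ℝ) * η := by positivity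
    set α := ((m + 1 : ℕ) : ℝ) * η with hαdef
    set ν := betaMeasure α η with hν
    have : IsProbabilityMeasure ν := isProbabilityMeasureBeta hα hη
    have hmeas : Measurable fun p : ℝ × ℝ => p.2 * p.1 + (1 - p.2) * c (m + 1) := by fun_prop
    -- A Dirichlet vector with one more coordinate is (B X, 1 - B), with B independent of X and
    -- distributed as Beta((m+1)η, η).
    refine ⟨(μ.prod ν).map fun p => p.2 * p.1 + (1 - p.2) * c (m + 1),
      Measure.isProbabilityMeasure_map hmeas.aemeasurable, ?_, ?_, fun n => ?_⟩
    · rw [ae_map_iff hmeas.aemeasurable (measurableSet_le (by fun_prop) (by fun_prop))]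
      filter_upwards [Measure.quasiMeasurePreserving_fst.ae hμM,
        Measure.quasiMeasurePreserving_snd.ae (ae_betaMeasure_mem_Ioo α η)] with p h1 h2
      have h3 : 0 < 1 - p.2 := by linarith [h2.2]
      calc |p.2 * p.1 + (1 - p.2) * c (m + 1)| ≤ p.2 * |p.1| + (1 - p.2) * |c (m + 1)| := by
            refine (abs_add_le _ _).trans_eq ?_
            rw [abs_mul, abs_mul, abs_of_pos h2.1, abs_of_pos h3]
        _ ≤ p.2 * M + (1 - p.2) * M := by
            gcongr
            · exact h2.1.le
            · exact hc _
        _ = M := by ring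
    · intro i hi δ hδ
      -- Changing b by at most ε moves the convex combination by at most 2Mε < δ/2; the extra 2
      -- keeps the denominator positive when M = 0.
      set ε := min 1 (δ / (4 * M + 2)) with hε
      have hε0 : 0 < ε := lt_min one_pos (by positivity)
      have hε1 : ε ≤ 1 := min_le_left _ _
      have hε2 : ε * (2 * M) < δ / 2 := by
        have : ε * (4 * M + 2) ≤ δ := by
          rw [← le_div_iff₀ (by positivity)]; exact min_le_right _ _
        nlinarith
      obtain ⟨s, t, hs, ht, hst⟩ : ∃ s t : Set ℝ, 0 < μ s ∧ 0 < ν t ∧ ∀ x ∈ s, ∀ b ∈ t,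
          |b * x + (1 - b) * c (m + 1) - c i| < δ := by
        rcases Nat.le_succ_iff.1 hi with hi | rfl
        -- Old node: x close to c i and b close to 1.
        · refine ⟨_, _, hμb i hi (δ / 2) (by positivity),
            betaMeasure_Ioo_pos hα hη (u := 1 - ε) (v := 1) (by linarith) (by linarith) le_rfl,
            fun x hx b hb => ?_⟩
          rw [Metric.mem_ball, Real.dist_eq] at hx
          have hb1 : 0 < 1 - b := by linarith [hb.2]
          have hb0 : 0 ≤ b := by linarith [hb.1]
          have h4 : |c (m + 1) - c i| ≤ 2 * M := by
            linarith [abs_sub (c (m + 1)) (c i), hc (m + 1), hc i]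
          calc |b * x + (1 - b) * c (m + 1) - c i|
              = |b * (x - c i) + (1 - b) * (c (m + 1) - c i)| := by congr 1; ring
            _ ≤ b * |x - c i| + (1 - b) * |c (m + 1) - c i| := by
              refine (abs_add_le _ _).trans_eq ?_
              rw [abs_mul, abs_mul, abs_of_nonneg hb0, abs_of_pos hb1]
            _ ≤ 1 * |x - c i| + ε * (2 * M) := by
              gcongr
              · linarith [hb.2]
              · linarith [hb.1]
            _ < δ := by linarith
        -- New node: b close to 0, with x arbitrary in the support.
        · refine ⟨{x | |x| ≤ M}, Set.Ioo 0 ε, ?_,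
            betaMeasure_Ioo_pos hα hη le_rfl hε0 hε1, fun x hx b hb => ?_⟩
          · rw [prob_compl_eq_zero_iff (measurableSet_le (by fun_prop) (by fun_prop)) |>.1 hμM]
            exact one_pos
          · have h4 : |x - c (m + 1)| ≤ 2 * M := by
              linarith [abs_sub x (c (m + 1)), hc (m + 1), show |x| ≤ M from hx]
            calc |b * x + (1 - b) * c (m + 1) - c (m + 1)| = |b * (x - c (m + 1))| := by
                  congr 1; ring
              _ = b * |x - c (m + 1)| := by rw [abs_mul, abs_of_pos hb.1]
              _ ≤ ε * (2 * M) := by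
                gcongr
                exact hb.2.le
              _ < δ := by linarith
      rw [Measure.map_apply hmeas Metric.isOpen_ball.measurableSet]
      refine lt_of_lt_of_le ?_ (measure_mono (μ := μ.prod ν) (s := s ×ˢ t) ?_)
      · rw [Measure.prod_prod]; exact ENNReal.mul_pos hs.ne' ht.ne'
      · rintro ⟨x, b⟩ ⟨hx, hb⟩
        exact hst x hx b hb
    -- The factor (α)_i of the beta moment cancels the denominator of the inductive moment, leaving
    -- the Cauchy product that defines `dirichletCoeff`.
    · rw [betaMixture_moment hα hη hν hμM, dirichletCoeff, Finset.mul_sum, Finset.sum_div]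
      refine Finset.sum_congr rfl fun p hp => ?_
      have hsum : ((m + 1 + 1 : ℕ) : ℝ) * η = α + η := by rw [hαdef]; push_cast; ring
      have h1 := (ascPochhammer_pos p.1 α hα).ne'
      have h2 := (ascPochhammer_pos n (α + η) (by positivity)).ne'
      rw [hμm, hsum, risingCoeff]
      have h3 : (n.choose p.1 : ℝ) * p.1.factorial * p.2.factorial = n.factorial := by
        rw [← Finset.HasAntidiagonal.mem_antidiagonal.1 hp, Nat.choose_symm_add]
        exact_mod_cast Nat.add_choose_mul_factorial_mul_factorial p.1 p.2
      rw [← h3]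
      field_simp
end

/-! ### Fourier transforms of compactly supported probability measures -/

noncomputable section

open MeasureTheory ProbabilityTheory

/-- The Fourier–Stieltjes transform `∫ e^{-i z x} dμ(x)`, as a function of a complex variable. -/
def fourierStieltjes (μ : Measure ℝ) (z : ℂ) : ℂ := ∫ x : ℝ, Complex.exp (-(Complex.I * z) * x) ∂μ

section FourierStieltjes

variable {μ : Measure ℝ} [IsProbabilityMeasure μ] {M : ℝ}

lemma norm_exp_neg_I_mul_le (z : ℂ) {x : ℝ} (hx : |x| ≤ M) :
    ‖Complex.exp (-(Complex.I * z) * x)‖ ≤ Real.exp (M * ‖z‖) := by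
  refine (Complex.norm_exp_le_exp_norm _).trans (Real.exp_le_exp.2 ?_)
  rw [norm_mul, norm_neg, norm_mul, Complex.norm_I, one_mul, Complex.norm_real, Real.norm_eq_abs,
    mul_comm]
  gcongr

lemma integrable_exp_neg_I_mul (hM : ∀ᵐ x ∂μ, |x| ≤ M) (z : ℂ) :
    Integrable (fun x : ℝ => Complex.exp (-(Complex.I * z) * x)) μ := by
  refine Integrable.of_bound (by fun_prop) (Real.exp (M * ‖z‖)) ?_
  filter_upwards [hM] with x hx using norm_exp_neg_I_mul_le z hx

lemma norm_fourierStieltjes_le (hM : ∀ᵐ x ∂μ, |x| ≤ M) (z : ℂ) :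
    ‖fourierStieltjes μ z‖ ≤ Real.exp (M * ‖z‖) := by
  have := norm_integral_le_of_norm_le_const (μ := μ) (C := Real.exp (M * ‖z‖))
    (f := fun x : ℝ => Complex.exp (-(Complex.I * z) * x))
    (by filter_upwards [hM] with x hx using norm_exp_neg_I_mul_le z hx)
  simpa only [fourierStieltjes, probReal_univ, mul_one] using this

lemma differentiable_fourierStieltjes (hM : ∀ᵐ x ∂μ, |x| ≤ M) :
    Differentiable ℂ (fourierStieltjes μ) := by
  have huniv : integrableExpSet id μ = Set.univ := by
    refine Set.eq_univ_of_forall fun t => ?_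
    refine Integrable.of_bound (by fun_prop) (Real.exp (|t| * M)) ?_
    filter_upwards [hM] with x hx
    rw [Real.norm_eq_abs, Real.abs_exp]
    refine Real.exp_le_exp.2 ((le_abs_self _).trans ?_)
    rw [abs_mul]
    exact mul_le_mul_of_nonneg_left hx (abs_nonneg _)
  intro z
  have h := (hasDerivAt_complexMGF (X := id) (μ := μ) (z := -(Complex.I * z))
    (by simp [huniv])).differentiableAt
  have h2 : DifferentiableAt ℂ (fun z : ℂ => -(Complex.I * z)) z := by fun_prop
  exact DifferentiableAt.comp (g := complexMGF id μ) z h h2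

lemma isPositiveDefiniteFun_fourierStieltjes (hM : ∀ᵐ x ∂μ, |x| ≤ M) :
    IsPositiveDefiniteFun fun w : ℝ => fourierStieltjes μ (w : ℂ) := by
  refine ⟨(differentiable_fourierStieltjes hM).continuous.comp Complex.continuous_ofReal,
    fun n v z => ?_⟩
  set g : ℝ → ℂ := fun x => ∑ s, z s * Complex.exp (-(Complex.I * v s) * x) with hg
  -- The quadratic form is the integral of |g|².
  have key : ∑ s, ∑ l, z s * (starRingEnd ℂ) (z l) * fourierStieltjes μ ((v s - v l : ℝ) : ℂ) =
      ((∫ x, Complex.normSq (g x) ∂μ : ℝ) : ℂ) := by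
    rw [← integral_complex_ofReal]
    have e : ∀ x : ℝ, ((Complex.normSq (g x) : ℝ) : ℂ) = ∑ s, ∑ l, z s * (starRingEnd ℂ) (z l) *
        Complex.exp (-(Complex.I * ((v s - v l : ℝ) : ℂ)) * x) := by
      intro x
      rw [← Complex.mul_conj, hg, map_sum, Finset.sum_mul_sum]
      refine Finset.sum_congr rfl fun s _ => Finset.sum_congr rfl fun l _ => ?_
      rw [map_mul, ← Complex.exp_conj]
      simp only [map_mul, map_neg, Complex.conj_I, Complex.conj_ofReal]
      rw [show -(Complex.I * ((v s - v l : ℝ) : ℂ)) * x =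
        -(Complex.I * v s) * x + -(-Complex.I * v l) * x by push_cast; ring, Complex.exp_add]
      ring
    simp_rw [e]
    rw [integral_finsetSum]
    · refine Finset.sum_congr rfl fun s _ => ?_
      rw [integral_finsetSum]
      · exact Finset.sum_congr rfl fun l _ => (integral_const_mul _ _).symm
      · exact fun l _ => (integrable_exp_neg_I_mul hM _).const_mul _
    · exact fun s _ => integrable_finsetSum _ fun l _ =>
        (integrable_exp_neg_I_mul hM _).const_mul _
  simp only
  rw [key, Complex.zero_le_real]
  exact integral_nonneg fun x => Complex.normSq_nonneg _

lemma hasSum_fourierStieltjes (hM : ∀ᵐ x ∂μ, |x| ≤ M) (z : ℂ) :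
    HasSum (fun n : ℕ => (-(Complex.I * z)) ^ n / n.factorial * ((∫ x, x ^ n ∂μ : ℝ) : ℂ))
      (fourierStieltjes μ z) := by
  have h : HasSum
      (fun n : ℕ => ∫ x : ℝ, (-(Complex.I * z)) ^ n / n.factorial * ((x ^ n : ℝ) : ℂ) ∂μ)
      (∫ x : ℝ, Complex.exp (-(Complex.I * z) * x) ∂μ) := by
    refine hasSum_integral_of_dominated_convergence
      (fun n _ => (‖z‖ * M) ^ n / n.factorial) (fun n => by fun_prop) (fun n => ?_)
      (Filter.Eventually.of_forall fun x => Real.summable_pow_div_factorial _)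
      (integrable_const _) (Filter.Eventually.of_forall fun x => ?_)
    · filter_upwards [hM] with x hx
      rw [norm_mul, norm_div, norm_pow, norm_neg, norm_mul, Complex.norm_I, one_mul,
        Complex.norm_natCast, Complex.norm_real, Real.norm_eq_abs, abs_pow, div_mul_eq_mul_div,
        ← mul_pow]
      gcongr
    · have := NormedSpace.expSeries_div_hasSum_exp (𝔸 := ℂ) (-(Complex.I * z) * x)
      rw [← Complex.exp_eq_exp_ℂ] at this
      refine Eq.subst (motive := fun f => HasSum f _) (funext fun n => ?_) this
      rw [mul_pow]
      push_cast
      ring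
  refine Eq.subst (motive := fun f => HasSum f _) (funext fun n => ?_) h
  rw [integral_const_mul, integral_complex_ofReal]

lemma fourierStieltjes_zero : fourierStieltjes μ 0 = 1 := by simp [fourierStieltjes]

/-- On the imaginary half-axis pointing towards c the transform is a real exponential moment, and
the mass near c alone makes it grow like e^{(M-δ)y}. -/
lemma le_of_fourierStieltjes_bound (hM : ∀ᵐ x ∂μ, |x| ≤ M) {c : ℝ} (hcM : |c| = M)
    (hc : ∀ δ > 0, 0 < μ (Metric.ball c δ)) {s C : ℝ}
    (hs : ∀ z : ℂ, ‖fourierStieltjes μ z‖ ≤ C * Real.exp (s * ‖z‖)) : M ≤ s := by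
  by_contra! hlt
  -- With this choice M - δ = s + δ, so growth beats the bound by e^{δy}.
  set δ := (M - s) / 2 with hδ
  have hδ0 : 0 < δ := by rw [hδ]; linarith
  obtain ⟨σ, hσ, hσc⟩ : ∃ σ : ℝ, |σ| = 1 ∧ σ * c = M := by
    rcases le_total 0 c with h | h
    · exact ⟨1, by simp, by rw [one_mul, ← hcM, abs_of_nonneg h]⟩
    · exact ⟨-1, by simp, by rw [neg_one_mul, ← hcM, abs_of_nonpos h]⟩
  set p := μ.real (Metric.ball c δ) with hp
  have hp0 : 0 < p := ENNReal.toReal_pos (hc δ hδ0).ne' (measure_ne_top _ _)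
  have key : ∀ y : ℝ, 0 ≤ y → p * Real.exp (y * δ) ≤ C := by
    intro y hy
    have h1 := hs (Complex.I * (y * σ : ℝ))
    have h2 : fourierStieltjes μ (Complex.I * (y * σ : ℝ)) =
        ((∫ x, Real.exp (y * σ * x) ∂μ : ℝ) : ℂ) := by
      rw [fourierStieltjes, ← integral_complex_ofReal]
      refine integral_congr_ae (Filter.Eventually.of_forall fun x => ?_)
      simp only [← mul_assoc, Complex.I_mul_I]
      push_cast
      congr 1
      ring
    have hint : Integrable (fun x : ℝ => Real.exp (y * σ * x)) μ := by
      refine Integrable.of_bound (by fun_prop) (Real.exp (y * M)) ?_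
      filter_upwards [hM] with x hx
      rw [Real.norm_eq_abs, Real.abs_exp]
      refine Real.exp_le_exp.2 ((le_abs_self _).trans ?_)
      rw [abs_mul, abs_mul, hσ, abs_of_nonneg hy, mul_one]
      exact mul_le_mul_of_nonneg_left hx hy
    have h3 : p * Real.exp (y * (M - δ)) ≤ ∫ x, Real.exp (y * σ * x) ∂μ := by
      calc p * Real.exp (y * (M - δ)) = ∫ _ in Metric.ball c δ, Real.exp (y * (M - δ)) ∂μ := by
            rw [setIntegral_const, smul_eq_mul]
        _ ≤ ∫ x in Metric.ball c δ, Real.exp (y * σ * x) ∂μ := by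
            refine setIntegral_mono_on integrableOn_const hint.integrableOn
              Metric.isOpen_ball.measurableSet fun x hx => Real.exp_le_exp.2 ?_
            rw [Metric.mem_ball, Real.dist_eq] at hx
            rw [mul_assoc]
            refine mul_le_mul_of_nonneg_left ?_ hy
            have : |σ * (x - c)| < δ := by rwa [abs_mul, hσ, one_mul]
            have := (abs_lt.1 this).1
            rw [mul_sub, hσc] at this
            linarith
        _ ≤ _ := setIntegral_le_integral hint
            (Filter.Eventually.of_forall fun x => (Real.exp_pos _).le)
    rw [h2, Complex.norm_real, Real.norm_eq_abs, norm_mul, Complex.norm_I, one_mul,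
      Complex.norm_real, Real.norm_eq_abs, abs_mul, hσ, mul_one, abs_of_nonneg hy] at h1
    have h4 := (h3.trans (le_abs_self _)).trans h1
    rw [show y * (M - δ) = y * δ + s * y by rw [hδ]; ring, Real.exp_add, ← mul_assoc] at h4
    exact le_of_mul_le_mul_right h4 (Real.exp_pos _)
  have hC : 0 < C := by
    have := key 0 le_rfl
    simp only [zero_mul, Real.exp_zero, mul_one] at this
    linarith
  -- At this y, p e^{yδ} ≥ p (1 + yδ) = C + p > C.
  have := key (C / (p * δ)) (by positivity)
  have h5 := Real.add_one_le_exp (C / (p * δ) * δ)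
  have h6 : p * (C / (p * δ) * δ + 1) = C + p := by field_simp
  nlinarith

lemma isEntireOfExponentialType_fourierStieltjes (hM : ∀ᵐ x ∂μ, |x| ≤ M) {c : ℝ} (hcM : |c| = M)
    (hc : ∀ δ > 0, 0 < μ (Metric.ball c δ)) :
    IsEntireOfExponentialType (fourierStieltjes μ) M := by
  refine ⟨differentiable_fourierStieltjes hM, ⟨hcM ▸ abs_nonneg c, fun ε hε => ⟨1, fun z => ?_⟩⟩,
    fun s hs => le_of_forall_pos_le_add fun ε hε => ?_⟩
  · refine (norm_fourierStieltjes_le hM z).trans ?_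
    rw [one_mul]
    gcongr
    linarith
  · obtain ⟨C, hC⟩ := hs.2 ε hε
    exact le_of_fourierStieltjes_bound hM hcM hc hC

end FourierStieltjes
end

/-! ### Rearrangement of double series -/

noncomputable section

open Finset.HasAntidiagonal (antidiagonal)

lemma hasSum_sum_antidiagonal {f : ℕ × ℕ → ℝ} {s : ℝ} (h : HasSum f s) :
    HasSum (fun n => ∑ p ∈ antidiagonal n, f p) s := by
  have := (Finset.HasAntidiagonal.sigmaAntidiagonalEquivProd.hasSum_iff.2 h).sigma fun n => hasSum_fintype _
  refine Eq.subst (motive := fun g => HasSum g _) (funext fun n => ?_) this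
  exact (Finset.sum_coe_sort (antidiagonal n) f)

lemma hasSum_antidiagonal_of_rows {f : ℕ × ℕ → ℝ} {g g' : ℕ → ℝ} {s : ℝ}
    (hf : ∀ k, HasSum (fun i => f (k, i)) (g k)) (hg' : ∀ k, HasSum (fun i => |f (k, i)|) (g' k))
    (hs : Summable g') (hg : HasSum g s) :
    HasSum (fun n => ∑ p ∈ antidiagonal n, f p) s := by
  have habs : Summable fun p => |f p| := by
    rw [summable_prod_of_nonneg fun p => abs_nonneg _]
    refine ⟨fun k => (hg' k).summable, ?_⟩
    simpa only [(hg' _).tsum_eq] using hs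
  have h := habs.of_abs.hasSum
  have h2 := (h.prod_fiberwise hf).unique hg
  exact hasSum_sum_antidiagonal (h2 ▸ h)

/-! ### The generating function of the Gegenbauer polynomials -/

lemma sum_antidiagonal_eq_gegenbauerC (η τ : ℝ) (j : ℕ) :
    ∑ p ∈ antidiagonal j, risingCoeff η p.1 * (p.1.choose p.2 * ((2 * τ) ^ (p.1 - p.2) * (-1) ^ p.2))
      = gegenbauerC η j τ := by
  rw [gegenbauerC, Finset.Nat.sum_antidiagonal_eq_sum_range_succ_mk,
    ← Finset.sum_range_reflect]
  symm
  refine Finset.sum_subset_zero_on_sdiff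
    (Finset.range_subset_range.2 (by omega)) (fun k hk => ?_) fun k hk => ?_
  · simp only [Finset.mem_sdiff, Finset.mem_range, not_lt] at hk
    rw [Nat.choose_eq_zero_of_lt (by omega)]
    simp
  · rw [Finset.mem_range] at hk
    have h1 : j + 1 - 1 - k = j - k := by omega
    have h2 : j - (j - k) = k := by omega
    simp only [h1, h2]
    have h3 : j - k - k = j - 2 * k := by omega
    rw [Nat.choose_eq_factorial_div_factorial (by omega), h3, Nat.cast_div
      (h3 ▸ Nat.factorial_mul_factorial_dvd_factorial (by omega)) (by positivity), risingCoeff]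
    push_cast
    have : ((j - k).factorial : ℝ) ≠ 0 := by positivity
    field_simp

/-- Write 1 - 2τv + v² = 1 - v(2τ - v) and expand by the binomial series, then the binomial theorem.
For v ≤ 1/3, v(2|τ| + v) ≤ 7/9, which gives absolute convergence. -/
lemma hasSum_gegenbauerC {η τ v : ℝ} (hη : 0 < η) (hτ : |τ| ≤ 1) (hv0 : 0 ≤ v) (hv : v ≤ 1 / 3) :
    HasSum (fun j => gegenbauerC η j τ * v ^ j) ((1 - 2 * τ * v + v ^ 2) ^ (-η)) := by
  set f : ℕ × ℕ → ℝ := fun p =>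
    risingCoeff η p.1 * v ^ p.1 * (p.1.choose p.2 * ((2 * τ) ^ (p.1 - p.2) * (-v) ^ p.2)) with hf
  have hrow : ∀ (s t : ℝ) (m : ℕ), HasSum
      (fun k : ℕ => (m.choose k : ℝ) * (s ^ (m - k) * t ^ k)) ((s + t) ^ m) := by
    intro s t m
    have e : (s + t) ^ m =
        ∑ k ∈ Finset.range (m + 1), (m.choose k : ℝ) * (s ^ (m - k) * t ^ k) := by
      rw [add_comm, add_pow]
      exact Finset.sum_congr rfl fun k _ => by ring
    rw [e]
    refine hasSum_sum_of_ne_finset_zero fun k hk => ?_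
    rw [Nat.choose_eq_zero_of_lt (by simpa using hk)]
    simp
  have habs : |v * (2 * |τ| + v)| < 1 := by
    rw [abs_of_nonneg (by positivity)]
    nlinarith
  have habs' : |v * (2 * τ + -v)| < 1 := by
    refine lt_of_le_of_lt ?_ habs
    rw [abs_mul, abs_mul]
    refine mul_le_mul_of_nonneg_left ?_ (abs_nonneg v)
    calc |2 * τ + -v| ≤ |2 * τ| + |-v| := abs_add_le _ _
      _ = 2 * |τ| + v := by rw [abs_mul, abs_neg, abs_of_nonneg hv0, Nat.abs_ofNat]
      _ ≤ _ := le_abs_self _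
  have h := hasSum_antidiagonal_of_rows (f := f)
    (g := fun m => risingCoeff η m * (v * (2 * τ + -v)) ^ m)
    (g' := fun m => risingCoeff η m * (v * (2 * |τ| + v)) ^ m)
    (s := (1 - v * (2 * τ + -v)) ^ (-η))
    (fun m => by
      simp only [hf, mul_pow _ _ m, ← mul_assoc (risingCoeff η m)]
      exact (hrow _ _ m).mul_left _)
    (fun m => by
      simp only [hf, mul_pow _ _ m, ← mul_assoc (risingCoeff η m), abs_mul, abs_pow, abs_neg,
        abs_of_nonneg hv0, abs_of_nonneg (risingCoeff_nonneg hη.le m), Nat.abs_cast, Nat.abs_ofNat]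
      exact (hrow (2 * |τ|) v m).mul_left (risingCoeff η m * v ^ m))
    (hasSum_risingCoeff η habs).summable (hasSum_risingCoeff η habs')
  rw [show 1 - v * (2 * τ + -v) = 1 - 2 * τ * v + v ^ 2 by ring] at h
  refine Eq.subst (motive := fun g => HasSum g _) (funext fun j => ?_) h
  rw [← sum_antidiagonal_eq_gegenbauerC, Finset.sum_mul]
  refine Finset.sum_congr rfl fun p hp => ?_
  simp only [hf]
  rw [← Finset.HasAntidiagonal.mem_antidiagonal.1 hp, pow_add, neg_pow v]
  ring

/-! ### Powers of the generating function of the Catalan numbers -/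

/-- The coefficient `ν / (ν + 2k) * (ν + 2k choose k)` of `x ^ k` in the `ν`-th power of the
generating function of the Catalan numbers. -/
def catalanCoeff (ν : ℝ) (k : ℕ) : ℝ := ν / (ν + k) * risingCoeff (ν + k) k

lemma catalanCoeff_nonneg {ν : ℝ} (hν : 0 < ν) (k : ℕ) : 0 ≤ catalanCoeff ν k :=
  mul_nonneg (by positivity) (risingCoeff_nonneg (by positivity) k)

lemma catalanCoeff_le {ν : ℝ} (hν : 0 < ν) (k : ℕ) : catalanCoeff ν k ≤ 2 ^ ν * 4 ^ k := by
  have h1 : catalanCoeff ν k ≤ risingCoeff (ν + k) k := by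
    refine mul_le_of_le_one_left (risingCoeff_nonneg (by positivity) k) ?_
    rw [div_le_one (by positivity)]
    linarith [(k.cast_nonneg : (0 : ℝ) ≤ k)]
  -- A single term of a series of nonnegative terms is at most its sum, here 2^(ν+k).
  have h2 := hasSum_risingCoeff (ν + k) (x := 1 / 2) (by rw [abs_of_pos] <;> norm_num)
  have h3 := le_hasSum h2 k fun n _ =>
    mul_nonneg (risingCoeff_nonneg (by positivity) n) (by positivity)
  rw [show (1 - 1 / 2 : ℝ) = 2⁻¹ by norm_num, Real.rpow_neg (by norm_num),
    Real.inv_rpow (by norm_num), inv_inv, Real.rpow_add_natCast (by norm_num), one_div, inv_pow,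
    ← div_eq_mul_inv, div_le_iff₀ (by positivity)] at h3
  calc _ ≤ _ := h1
    _ ≤ _ := h3
    _ = _ := by rw [mul_assoc, ← mul_pow]; norm_num

lemma catalanCoeff_mul_risingCoeff {ν : ℝ} (hν : 0 < ν) (k i : ℕ) :
    catalanCoeff ν k * risingCoeff (ν + 2 * k) i * (ν + k) =
      ν * ((ascPochhammer ℝ (k + i)).eval (ν + k) / (k.factorial * i.factorial)) := by
  rw [catalanCoeff, risingCoeff, risingCoeff, ascPochhammer_eval_add,
    show ν + k + k = ν + 2 * k by ring]
  have : ν + k ≠ 0 := by positivity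
  field_simp

/-- For n > 0 the sum is, up to a factor, the n-th finite difference of a polynomial of degree n -
1, hence zero. It expresses ∑ `catalanCoeff ν k` y^k (1 + y)^(-(ν+2k)) = 1 coefficientwise. -/
lemma sum_catalanCoeff_mul_risingCoeff {ν : ℝ} (hν : 0 < ν) (n : ℕ) :
    ∑ p ∈ antidiagonal n, catalanCoeff ν p.1 * ((-1) ^ p.2 * risingCoeff (ν + 2 * p.1) p.2) =
      if n = 0 then 1 else 0 := by
  rcases n with _ | n
  · simp [catalanCoeff, hν.ne']
  rw [if_neg (by omega)]
  have hdeg : (ascPochhammer ℝ n).natDegree < n + 1 := by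
    rw [ascPochhammer_natDegree]; omega
  have h := congrFun (Polynomial.fwdDiff_iter_eq_zero_of_degree_lt hdeg) (ν + 1)
  rw [fwdDiff_iter_eq_sum_shift, Pi.zero_apply] at h
  rw [Finset.Nat.sum_antidiagonal_eq_sum_range_succ_mk]
  have e : ∀ k ∈ Finset.range (n + 1 + 1),
      catalanCoeff ν k * ((-1) ^ (n + 1 - k) * risingCoeff (ν + 2 * k) (n + 1 - k)) =
      ν / (n + 1).factorial * ((((-1) ^ (n + 1 - k) * (n + 1).choose k : ℤ)) •
        (ascPochhammer ℝ n).eval (ν + 1 + k • (1 : ℝ))) := by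
    intro k hk
    have hk' : k ≤ n + 1 := by simpa [Nat.lt_succ_iff] using hk
    have hpos : ν + k ≠ 0 := by positivity
    have h1 := catalanCoeff_mul_risingCoeff hν k (n + 1 - k)
    rw [Nat.add_sub_cancel' hk', ← add_comm 1 n, ascPochhammer_eval_add, ascPochhammer_one,
      Polynomial.eval_X, Nat.cast_one] at h1
    have h2 : ((n + 1).choose k : ℝ) * (k.factorial * (n + 1 - k).factorial) =
        (n + 1).factorial := by
      rw [← mul_assoc]
      exact_mod_cast Nat.choose_mul_factorial_mul_factorial hk'
    rw [zsmul_eq_mul, nsmul_eq_mul, mul_one, show ν + 1 + k = ν + k + 1 by ring, ← h2,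
      mul_left_comm]
    push_cast
    rw [add_comm n 1]
    have h3 : catalanCoeff ν k * risingCoeff (ν + 2 * k) (1 + n - k) =
        ν * ((ascPochhammer ℝ n).eval (ν + k + 1) / (k.factorial * (1 + n - k).factorial)) := by
      apply mul_right_cancel₀ hpos
      rw [h1]
      ring
    rw [h3]
    have h4 : ((1 + n).choose k : ℝ) ≠ 0 := by
      exact_mod_cast (Nat.choose_pos (by omega)).ne'
    field_simp
  rw [Finset.sum_congr rfl e, ← Finset.mul_sum, h, mul_zero]

lemma hasSum_catalanCoeff {ν y : ℝ} (hν : 0 < ν) (hy0 : 0 ≤ y) (hy : y ≤ 1 / 9) :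
    HasSum (fun k => catalanCoeff ν k * (y / (1 + y) ^ 2) ^ k) ((1 + y) ^ ν) := by
  set f : ℕ × ℕ → ℝ := fun p =>
    catalanCoeff ν p.1 * y ^ p.1 * (risingCoeff (ν + 2 * p.1) p.2 * (-y) ^ p.2) with hf
  have hy1 : 0 < 1 + y := by linarith
  have hy2 : 0 < 1 - y := by linarith
  have hrow : ∀ k, HasSum (fun i => f (k, i))
      (catalanCoeff ν k * y ^ k * (1 + y) ^ (-(ν + 2 * k))) := by
    intro k
    have := (hasSum_risingCoeff (ν + 2 * k) (x := -y)
      (by rw [abs_neg, abs_of_nonneg hy0]; linarith)).mul_left (catalanCoeff ν k * y ^ k)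
    rwa [sub_neg_eq_add] at this
  have hrow' : ∀ k, HasSum (fun i => |f (k, i)|)
      (catalanCoeff ν k * y ^ k * (1 - y) ^ (-(ν + 2 * k))) := by
    intro k
    have := (hasSum_risingCoeff (ν + 2 * k) (x := y)
      (by rw [abs_of_nonneg hy0]; linarith)).mul_left (catalanCoeff ν k * y ^ k)
    refine Eq.subst (motive := fun g => HasSum g _) (funext fun i => ?_) this
    rw [hf]
    simp only [abs_mul, abs_pow, abs_neg]
    rw [abs_of_nonneg hy0, abs_of_nonneg (catalanCoeff_nonneg hν k),
      abs_of_nonneg (risingCoeff_nonneg (by positivity) i)]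
  have hpow : ∀ (u : ℝ), 0 < u → ∀ k : ℕ, u ^ (-(ν + 2 * k)) = u ^ (-ν) * ((u ^ 2)⁻¹) ^ k := by
    intro u hu k
    rw [neg_add, Real.rpow_add hu, ← Nat.cast_two, ← Nat.cast_mul, Real.rpow_neg hu.le (_ : ℕ),
      Real.rpow_natCast, pow_mul, inv_pow]
  have hsumm : Summable fun k => catalanCoeff ν k * y ^ k * (1 - y) ^ (-(ν + 2 * k)) := by
    -- The bound y ≤ 1/9 gives a ratio of at most 9/16.
    have hq : 4 * y * ((1 - y) ^ 2)⁻¹ < 1 := by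
      rw [← div_eq_mul_inv, div_lt_one (by positivity)]
      nlinarith
    refine Summable.of_nonneg_of_le (fun k => ?_) (fun k => ?_)
      ((summable_geometric_of_lt_one (by positivity) hq).mul_left (2 ^ ν * (1 - y) ^ (-ν)))
    · have := catalanCoeff_nonneg hν k
      positivity
    · rw [hpow _ hy2]
      calc _ ≤ 2 ^ ν * 4 ^ k * y ^ k * ((1 - y) ^ (-ν) * ((1 - y) ^ 2)⁻¹ ^ k) := by
            gcongr
            exact catalanCoeff_le hν k
        _ = _ := by rw [mul_pow, mul_pow]; ring
  have hsumm' : Summable fun k => catalanCoeff ν k * y ^ k * (1 + y) ^ (-(ν + 2 * k)) := by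
    refine Summable.of_nonneg_of_le (fun k => ?_) (fun k => ?_) hsumm
    · have := catalanCoeff_nonneg hν k
      positivity
    · have := catalanCoeff_nonneg hν k
      refine mul_le_mul_of_nonneg_left ?_ (by positivity)
      exact Real.rpow_le_rpow_of_nonpos hy2 (by linarith) (by linarith [(k.cast_nonneg : (0:ℝ) ≤ k)])
  have h := hasSum_antidiagonal_of_rows hrow hrow' hsumm hsumm'.hasSum
  have h1 : HasSum (fun n => ∑ p ∈ antidiagonal n, f p) 1 := by
    refine Eq.subst (motive := fun g => HasSum g _) (funext fun n => ?_) (hasSum_ite_eq 0 (1 : ℝ))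
    rw [show (if n = 0 then (1 : ℝ) else 0) = (if n = 0 then 1 else 0) * y ^ n by
      split_ifs with h <;> simp [h], ← sum_catalanCoeff_mul_risingCoeff hν, Finset.sum_mul]
    refine Finset.sum_congr rfl fun p hp => ?_
    simp only [hf]
    rw [← Finset.HasAntidiagonal.mem_antidiagonal.1 hp, pow_add, neg_pow y]
    ring
  have h2 := (h.unique h1 ▸ hsumm'.hasSum).mul_right ((1 + y) ^ ν)
  rw [one_mul] at h2
  refine Eq.subst (motive := fun g => HasSum g _) (funext fun k => ?_) h2
  rw [hpow _ hy1, Real.rpow_neg hy1.le, div_pow, inv_pow]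
  have : (1 + y) ^ ν ≠ 0 := (Real.rpow_pos_of_pos hy1 ν).ne'
  field_simp
end

/-! ### Two expansions of the product over the nodes -/

noncomputable section


lemma hasSum_dirichletCoeff (η : ℝ) {c : ℕ → ℝ} (hc : ∀ i, |c i| ≤ 1) {z : ℝ} (hz : |z| < 1)
    (m : ℕ) :
    HasSum (fun n => dirichletCoeff η c m n * z ^ n)
      (∏ i ∈ Finset.range m, (1 - c i * z) ^ (-η)) := by
  induction m with
  | zero =>
    rw [Finset.prod_range_zero]
    refine Eq.subst (motive := fun g => HasSum g _) (funext fun n => ?_) (hasSum_ite_eq 0 (1 : ℝ))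
    by_cases h : n = 0 <;> simp [dirichletCoeff, h]
  | succ m ih =>
    have hcz : |c m * z| < 1 := by
      rw [abs_mul]
      exact (mul_le_of_le_one_left (abs_nonneg z) (hc m)).trans_lt hz
    have h := hasSum_risingCoeff η hcz
    have hs := summable_mul_of_summable_norm ih.summable.norm h.summable.norm
    rw [Finset.prod_range_succ]
    have := hasSum_sum_antidiagonal (ih.mul h hs)
    refine Eq.subst (motive := fun g => HasSum g _) (funext fun n => ?_) this
    rw [dirichletCoeff, Finset.sum_mul]
    refine Finset.sum_congr rfl fun p hp => ?_
    rw [← Finset.HasAntidiagonal.mem_antidiagonal.1 hp, pow_add, mul_pow]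
    ring

/-- Each factor is |v - ζ|² with ζ running over the R-th roots of e^{iq}, so the product is |v^R -
e^{iq}|². -/
lemma prod_one_sub_cos (q v : ℝ) {R : ℕ} (hR : 0 < R) :
    ∏ l ∈ Finset.range R, (1 - 2 * Real.cos ((q + 2 * Real.pi * l) / R) * v + v ^ 2) =
      1 - 2 * Real.cos q * v ^ R + (v ^ R) ^ 2 := by
  have hR0 : (R : ℂ) ≠ 0 := by exact_mod_cast hR.ne'
  have hsq : ∀ θ u : ℝ, Complex.normSq ((u : ℂ) - Complex.exp (θ * Complex.I)) =
      1 - 2 * Real.cos θ * u + u ^ 2 := by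
    intro θ u
    rw [Complex.exp_mul_I, ← Complex.ofReal_cos, ← Complex.ofReal_sin, Complex.normSq_apply]
    simp only [Complex.sub_re, Complex.ofReal_re, Complex.add_re, Complex.mul_re, Complex.I_re,
      Complex.ofReal_im, Complex.I_im, Complex.sub_im, Complex.add_im, Complex.mul_im]
    linear_combination Real.sin_sq_add_cos_sq θ
  have hprim := Complex.isPrimitiveRoot_exp R hR.ne'
  have e : Complex.exp (((q / R : ℝ) : ℂ) * Complex.I) ^ R = Complex.exp (q * Complex.I) := by
    rw [← Complex.exp_nat_mul]
    congr 1
    push_cast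
    field_simp
  have h := congrArg (Polynomial.eval (v : ℂ)) (X_pow_sub_C_eq_prod hprim hR e)
  simp only [Polynomial.eval_sub, Polynomial.eval_pow, Polynomial.eval_X, Polynomial.eval_C,
    Polynomial.eval_prod] at h
  have h2 := congrArg Complex.normSq h
  rw [map_prod, ← Complex.ofReal_pow, hsq] at h2
  rw [h2]
  refine Finset.prod_congr rfl fun l _ => ?_
  rw [← hsq]
  congr 2
  rw [← Complex.exp_nat_mul, ← Complex.exp_add]
  congr 1
  push_cast
  field_simp
  ring

/-- The function `(j, k) ↦ R j + 2 k`. -/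
def doubleDegree (R : ℕ) (p : ℕ × ℕ) : ℕ := R * p.1 + 2 * p.2

/-- The coefficients of the expansion of the Gegenbauer generating function, with `v ^ R` as its
argument, in powers of `z = 2 v / (1 + v ^ 2)`. -/
def doubleCoeff (η τ : ℝ) (R : ℕ) (p : ℕ × ℕ) : ℝ :=
  gegenbauerC η p.1 τ * catalanCoeff (R * (η + p.1)) p.2 / 2 ^ doubleDegree R p

/-- Summing over k first gives a power of 1 + v² by the Catalan expansion; the sum over j is then
the Gegenbauer generating function at v^R. -/
lemma hasSum_doubleCoeff {η τ v : ℝ} {R : ℕ} (hη : 0 < η) (hR : 0 < R) (hτ : |τ| ≤ 1)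
    (hv0 : 0 < v) (hv : v ≤ 1 / 3) :
    HasSum (fun p => doubleCoeff η τ R p * (2 * v / (1 + v ^ 2)) ^ doubleDegree R p)
      ((1 + v ^ 2) ^ (R * η) * (1 - 2 * τ * v ^ R + (v ^ R) ^ 2) ^ (-η)) := by
  have hy : v ^ 2 ≤ 1 / 9 := by nlinarith
  have hy1 : 0 < 1 + v ^ 2 := by positivity
  have hvR : v ^ R ≤ 1 / 3 := by
    refine (pow_le_pow_of_le_one hv0.le (by linarith) hR).trans ?_
    rw [pow_one]; exact hv
  have hterm : ∀ p : ℕ × ℕ, doubleCoeff η τ R p * (2 * v / (1 + v ^ 2)) ^ doubleDegree R p =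
      gegenbauerC η p.1 τ * (v ^ R) ^ p.1 * ((1 + v ^ 2) ^ (R * p.1))⁻¹ *
        (catalanCoeff (R * (η + p.1)) p.2 * (v ^ 2 / (1 + v ^ 2) ^ 2) ^ p.2) := by
    intro p
    rw [doubleCoeff, doubleDegree, div_pow, mul_pow, div_pow, ← pow_mul, ← pow_mul, ← pow_mul,
      pow_add v, pow_add (1 + v ^ 2)]
    field_simp
  have hν : ∀ j : ℕ, 0 < R * (η + j) := fun j => by positivity
  have hrow : ∀ j : ℕ, HasSum
      (fun k => doubleCoeff η τ R (j, k) * (2 * v / (1 + v ^ 2)) ^ doubleDegree R (j, k))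
      ((1 + v ^ 2) ^ (R * η) * (gegenbauerC η j τ * (v ^ R) ^ j)) := by
    intro j
    have := (hasSum_catalanCoeff (hν j) (sq_nonneg v) hy).mul_left
      (gegenbauerC η j τ * (v ^ R) ^ j * ((1 + v ^ 2) ^ (R * j))⁻¹)
    simp only [hterm]
    refine Eq.subst (motive := fun x => HasSum _ x) ?_ this
    rw [mul_add, Real.rpow_add hy1, ← Nat.cast_mul, Real.rpow_natCast]
    field_simp
  have hrow' : ∀ j : ℕ, HasSum
      (fun k => |doubleCoeff η τ R (j, k) * (2 * v / (1 + v ^ 2)) ^ doubleDegree R (j, k)|)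
      ((1 + v ^ 2) ^ (R * η) * |gegenbauerC η j τ * (v ^ R) ^ j|) := by
    intro j
    have := (hasSum_catalanCoeff (hν j) (sq_nonneg v) hy).mul_left
      (|gegenbauerC η j τ * (v ^ R) ^ j| * ((1 + v ^ 2) ^ (R * j))⁻¹)
    have habs : ∀ k, |doubleCoeff η τ R (j, k) * (2 * v / (1 + v ^ 2)) ^ doubleDegree R (j, k)| =
        |gegenbauerC η j τ * (v ^ R) ^ j| * ((1 + v ^ 2) ^ (R * j))⁻¹ *
        (catalanCoeff (R * (η + j)) k * (v ^ 2 / (1 + v ^ 2) ^ 2) ^ k) := by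
      intro k
      rw [hterm, abs_mul, abs_mul, abs_of_pos (a := ((1 + v ^ 2) ^ _)⁻¹) (by positivity),
        abs_of_nonneg (mul_nonneg (catalanCoeff_nonneg (hν j) k) (by positivity))]
    simp only [habs]
    refine Eq.subst (motive := fun x => HasSum _ x) ?_ this
    rw [mul_add, Real.rpow_add hy1, ← Nat.cast_mul, Real.rpow_natCast]
    field_simp
  have hg := hasSum_gegenbauerC hη hτ (pow_nonneg hv0.le R) hvR
  have hsum : Summable fun p : ℕ × ℕ =>
      doubleCoeff η τ R p * (2 * v / (1 + v ^ 2)) ^ doubleDegree R p := by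
    refine Summable.of_abs ((summable_prod_of_nonneg fun p => abs_nonneg _).2
      ⟨fun j => (hrow' j).summable, ?_⟩)
    simp only [(hrow' _).tsum_eq]
    exact hg.summable.abs.mul_left _
  have := (hsum.hasSum.prod_fiberwise hrow).unique (hg.mul_left _)
  exact this ▸ hsum.hasSum

/-- Identity theorem for power series. One expansion is needed only frequently near 0, since z =
2v/(1 + v²) with v > 0 reaches only positive z. -/
lemma eq_of_hasSum_pow_frequently {a b : ℕ → ℝ} {f : ℝ → ℝ}
    (ha : ∃ᶠ z in nhdsWithin 0 {0}ᶜ, HasSum (fun n => a n * z ^ n) (f z))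
    (hb : ∀ᶠ z in nhdsWithin 0 {0}ᶜ, HasSum (fun n => b n * z ^ n) (f z)) : a = b := by
  set d : ℕ → ℝ := fun n => a n - b n with hd
  have h0 : ∃ᶠ z in nhdsWithin (0 : ℝ) {0}ᶜ, z ≠ 0 ∧ HasSum (fun n => d n * z ^ n) 0 := by
    refine ((ha.and_eventually hb).and_eventually self_mem_nhdsWithin).mono fun z hz => ⟨hz.2, ?_⟩
    have := hz.1.1.sub hz.1.2
    simpa only [sub_self, hd, sub_mul] using this
  set p := FormalMultilinearSeries.ofScalars ℝ d with hp
  obtain ⟨z₀, hz₀, hs₀⟩ := h0.exists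
  have hrad : 0 < p.radius := by
    refine lt_of_lt_of_le ?_ (p.le_radius_of_summable (r := ‖z₀‖₊) ?_)
    · simpa using hz₀
    · refine hs₀.summable.norm.congr fun n => ?_
      rw [hp, FormalMultilinearSeries.ofScalars_norm, norm_mul, norm_pow, coe_nnnorm]
  have hps : HasFPowerSeriesAt p.sum p 0 := (p.hasFPowerSeriesOnBall hrad).hasFPowerSeriesAt
  have hsum : ∀ z, p.sum z = ∑' n, d n * z ^ n := fun z => by
    simp [FormalMultilinearSeries.sum, hp, mul_comm]
  have hev := hps.analyticAt.frequently_zero_iff_eventually_zero.1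
    (h0.mono fun z hz => (hsum z).trans hz.2.tsum_eq)
  have hz : p = 0 := HasFPowerSeriesAt.eq_zero (hps.congr hev)
  have hd0 : d = 0 := (FormalMultilinearSeries.ofScalars_series_eq_zero (E := ℝ)).1 hz
  funext n
  exact sub_eq_zero.1 (congrFun hd0 n)

lemma dirichletCoeff_eq_tsum {η q : ℝ} {R : ℕ} (hη : 0 < η) (hR : 0 < R) (n : ℕ) :
    dirichletCoeff η (fun l => Real.cos ((q + 2 * Real.pi * l) / R)) R n =
      ∑' p : doubleDegree R ⁻¹' {n}, doubleCoeff η (Real.cos q) R p := by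
  set c : ℕ → ℝ := fun l => Real.cos ((q + 2 * Real.pi * l) / R) with hc
  have hc1 : ∀ l, |c l| ≤ 1 := fun l => Real.abs_cos_le_one _
  symm
  revert n
  refine congrFun (eq_of_hasSum_pow_frequently
    (f := fun z => ∏ i ∈ Finset.range R, (1 - c i * z) ^ (-η)) ?_ ?_)
  · have key : ∀ v : ℝ, 0 < v → v ≤ 1 / 3 → HasSum
        (fun n => (∑' p : doubleDegree R ⁻¹' {n}, doubleCoeff η (Real.cos q) R p) *
          (2 * v / (1 + v ^ 2)) ^ n)
        (∏ i ∈ Finset.range R, (1 - c i * (2 * v / (1 + v ^ 2))) ^ (-η)) := by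
      intro v hv0 hv
      have h := (hasSum_doubleCoeff hη hR (Real.abs_cos_le_one q) hv0 hv).tsum_fiberwise
        (doubleDegree R)
      have hy1 : 0 < 1 + v ^ 2 := by positivity
      have hfac : ∀ i, 0 ≤ 1 - 2 * c i * v + v ^ 2 := fun i => by
        have := abs_le.1 (hc1 i)
        nlinarith [sq_nonneg (1 - v), mul_nonneg hv0.le (sub_nonneg.2 this.2)]
      have hprod : ∏ i ∈ Finset.range R, (1 - c i * (2 * v / (1 + v ^ 2))) ^ (-η) =
          (1 + v ^ 2) ^ (R * η) * (1 - 2 * Real.cos q * v ^ R + (v ^ R) ^ 2) ^ (-η) := by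
        rw [← prod_one_sub_cos q v hR, ← Real.finsetProd_rpow _ _ fun i _ => hfac i,
          mul_comm (R : ℝ), Real.rpow_mul_natCast hy1.le, ← Finset.card_range R,
          ← Finset.prod_const, Finset.card_range, ← Finset.prod_mul_distrib]
        refine Finset.prod_congr rfl fun i _ => ?_
        rw [show 1 - c i * (2 * v / (1 + v ^ 2)) = (1 + v ^ 2)⁻¹ * (1 - 2 * c i * v + v ^ 2) by
          field_simp; ring, Real.mul_rpow (by positivity) (hfac i), Real.inv_rpow hy1.le,
          Real.rpow_neg hy1.le, inv_inv]
      rw [hprod]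
      refine Eq.subst (motive := fun g => HasSum g _) (funext fun n => ?_) h
      rw [← tsum_mul_right]
      refine tsum_congr fun p => ?_
      rw [show doubleDegree R p = n from p.2]
    have ht : Filter.Tendsto (fun v : ℝ => 2 * v / (1 + v ^ 2)) (nhdsWithin 0 (Set.Ioi 0))
        (nhdsWithin 0 {0}ᶜ) := by
      refine tendsto_nhdsWithin_iff.2 ⟨?_, ?_⟩
      · have : Continuous fun v : ℝ => 2 * v / (1 + v ^ 2) :=
          by fun_prop (disch := intro v; positivity)
        simpa using (this.tendsto 0).mono_left nhdsWithin_le_nhds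
      · filter_upwards [self_mem_nhdsWithin] with v hv
        have : (0 : ℝ) < v := hv
        simp only [Set.mem_compl_iff, Set.mem_singleton_iff]
        positivity
    refine ht.frequently (Filter.Eventually.frequently ?_)
    filter_upwards [Ioc_mem_nhdsGT (show (0 : ℝ) < 1 / 3 by norm_num)] with v hv
      using key v hv.1 hv.2
  · have : ∀ᶠ z in nhds (0 : ℝ), |z| < 1 :=
      (continuous_abs.tendsto' 0 0 abs_zero).eventually (gt_mem_nhds one_pos)
    filter_upwards [nhdsWithin_le_nhds this] with z hz using hasSum_dirichletCoeff η hc1 hz R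
end

/-! ### The double series of Ψ -/

noncomputable section

/-- The `(j, k)`-th term of the double series of `Psi`, up to a complex factor of modulus `1`. -/
def psiDoubleTerm (η τ w : ℝ) (R : ℕ) (p : ℕ × ℕ) : ℝ :=
  R * (η + p.1) * Real.Gamma (R * η) * gegenbauerC η p.1 τ /
    (p.2.factorial * Real.Gamma (R * (η + p.1) + p.2 + 1)) * (w / 2) ^ doubleDegree R p

/-- With ν = R(η + j) and n = Rj + 2k, both (Rη)_n Γ(Rη) and (ν + k)_k Γ(ν + k) equal Γ(ν + 2k), so
the rising factorials cancel. -/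
lemma doubleCoeff_div_ascPochhammer {η : ℝ} (τ w : ℝ) {R : ℕ} (hη : 0 < η) (hR : 0 < R)
    (p : ℕ × ℕ) :
    doubleCoeff η τ R p / (ascPochhammer ℝ (doubleDegree R p)).eval (R * η) *
      w ^ doubleDegree R p = psiDoubleTerm η τ w R p := by
  obtain ⟨j, k⟩ := p
  have hx : 0 < R * η := by positivity
  have hν : 0 < R * (η + j) := by positivity
  have hνk : 0 < R * (η + j) + k := by positivity
  have h1 := Gamma_add_natCast hx (doubleDegree R (j, k))
  have h2 := Gamma_add_natCast hνk k
  have h3 := Real.Gamma_add_one hνk.ne'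
  have e : R * η + (doubleDegree R (j, k) : ℕ) = R * (η + j) + k + k := by
    simp only [doubleDegree]; push_cast; ring
  rw [e, h2] at h1
  have g1 := (Real.Gamma_pos_of_pos hx).ne'
  have g2 := (Real.Gamma_pos_of_pos hνk).ne'
  have a1 := (ascPochhammer_pos (doubleDegree R (j, k)) _ hx).ne'
  have a2 := (ascPochhammer_pos k _ hνk).ne'
  simp only [psiDoubleTerm, doubleCoeff, catalanCoeff, risingCoeff]
  rw [h3, (eq_div_iff g1).2 h1.symm, div_pow]
  have := hνk.ne'
  field_simp

lemma one_le_risingCoeff {s : ℝ} (hs : 1 ≤ s) (n : ℕ) : 1 ≤ risingCoeff s n := by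
  induction n with
  | zero => simp
  | succ n ih =>
    rw [risingCoeff_succ]
    exact one_le_mul_of_one_le_of_one_le ih ((one_le_div (by positivity)).2 (by linarith))

lemma exists_abs_gegenbauerC_le {η τ : ℝ} (hη : 0 < η) (hτ : |τ| ≤ 1) :
    ∃ B : ℝ, 0 ≤ B ∧ ∀ j, |gegenbauerC η j τ| ≤ B * 3 ^ j := by
  have h := (hasSum_gegenbauerC (v := 1 / 3) hη hτ (by norm_num) le_rfl).summable.abs
  refine ⟨∑' j, |gegenbauerC η j τ * 3⁻¹ ^ j|, tsum_nonneg fun j => abs_nonneg _, fun j => ?_⟩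
  have := h.le_tsum j fun i _ => abs_nonneg _
  rwa [abs_mul, one_div, inv_pow, abs_of_pos (a := ((3 : ℝ) ^ j)⁻¹) (by positivity),
    ← div_eq_mul_inv, div_le_iff₀ (by positivity)] at this

lemma summable_psiDoubleTerm {η τ w : ℝ} {R : ℕ} (hη : 0 < η) (hR : 0 < R) (hτ : |τ| ≤ 1)
    (hw : 0 < w) : Summable (psiDoubleTerm η τ w R) := by
  obtain ⟨B, hB0, hB⟩ := exists_abs_gegenbauerC_le hη hτ
  have hx : 0 < R * η := by positivity
  -- In 6 = 2 · 3, the 3 bounds the Gegenbauer growth and the 2 absorbs η + j ≤ (η + 1) 2^j.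
  have s1 := (Real.summable_pow_div_factorial (6 * (w / 2) ^ R)).mul_left (R * (η + 1) * B)
  have s2 := Real.summable_pow_div_factorial ((w / 2) ^ 2)
  have s3 := (s1.mul_of_nonneg s2 (fun j => by positivity) (fun k => by positivity)).mul_left
    (Real.Gamma (R * η) / Real.Gamma (R * η + 1))
  refine Summable.of_norm_bounded s3 fun p => ?_
  obtain ⟨j, k⟩ := p
  have g0 := Real.Gamma_pos_of_pos hx
  have g1 : 0 < Real.Gamma (R * η + 1) := Real.Gamma_pos_of_pos (by positivity)
  have hG : j.factorial * Real.Gamma (R * η + 1) ≤ Real.Gamma (R * (η + j) + k + 1) := by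
    have h1 : R * (η + j) + k + 1 = R * η + 1 + ((R * j + k : ℕ) : ℝ) := by push_cast; ring
    have h2 := one_le_risingCoeff (s := R * η + 1) (by linarith) (R * j + k)
    rw [risingCoeff, one_le_div (by positivity)] at h2
    rw [h1, Gamma_add_natCast (by positivity)]
    refine mul_le_mul_of_nonneg_right (le_trans ?_ h2) g1.le
    exact_mod_cast Nat.factorial_le (le_add_right (Nat.le_mul_of_pos_left j hR))
  have g2 : 0 < Real.Gamma (R * (η + j) + k + 1) := lt_of_lt_of_le (by positivity) hG
  have hj : η + j ≤ (η + 1) * 2 ^ j := by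
    have h1 : (j : ℝ) ≤ 2 ^ j := by exact_mod_cast Nat.lt_two_pow_self.le
    have h2 : (1 : ℝ) ≤ 2 ^ j := one_le_pow₀ (by norm_num)
    nlinarith
  have hw2 : 0 < w / 2 := by positivity
  simp only [psiDoubleTerm, doubleDegree]
  rw [Real.norm_eq_abs, abs_mul, abs_div, abs_mul,
    abs_of_pos (a := R * (η + j) * Real.Gamma (R * η)) (by positivity),
    abs_of_pos (a := _ * Real.Gamma _) (by positivity), abs_of_pos (a := _ ^ (_ + _)) (by positivity)]
  calc _ ≤ R * ((η + 1) * 2 ^ j) * Real.Gamma (R * η) * (B * 3 ^ j) /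
        (k.factorial * (j.factorial * Real.Gamma (R * η + 1))) * (w / 2) ^ (R * j + 2 * k) := by
        gcongr
        exact hB j
    _ = _ := by
        rw [show (6 : ℝ) = 2 * 3 by norm_num, mul_pow, mul_pow, pow_add, pow_mul, pow_mul]
        field_simp

lemma Psi_const_mul_psiTerm {η τ w : ℝ} {R : ℕ} (hη : 0 < η) (hR : 0 < R) (hw : 0 < w) (j : ℕ) :
    ((2 ^ (2 * η / (2 / R : ℝ)) * Real.Gamma ((2 * η + 2 / R) / (2 / R)) : ℝ) : ℂ) *
      psiTerm (2 / R) η w τ j =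
    ∑' k, (-(Complex.I * w)) ^ doubleDegree R (j, k) *
      ((doubleCoeff η τ R (j, k) /
        (ascPochhammer ℝ (doubleDegree R (j, k))).eval (R * η) : ℝ) : ℂ) := by
  have hR0 : (R : ℝ) ≠ 0 := by positivity
  have hR0' : (R : ℂ) ≠ 0 := by exact_mod_cast hR.ne'
  have hx : 0 < R * η := by positivity
  -- Since a = 2/R, the phase is (-i)^(Rj); the Bessel sign (-1)^k is (-i)^(2k), and together they
  -- give (-i)^(Rj+2k).
  have hphase : Complex.exp (-(Complex.I * Real.pi * j / ((2 / R : ℝ) : ℂ))) =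
      (-Complex.I) ^ (R * j) := by
    rw [← Complex.exp_neg_pi_div_two_mul_I, ← Complex.exp_nat_mul]
    congr 1
    push_cast
    field_simp
  have hterm : ∀ k, (-(Complex.I * w)) ^ doubleDegree R (j, k) *
      ((doubleCoeff η τ R (j, k) /
        (ascPochhammer ℝ (doubleDegree R (j, k))).eval (R * η) : ℝ) : ℂ) =
      (-Complex.I) ^ (R * j) * (((-1) ^ k * psiDoubleTerm η τ w R (j, k) : ℝ) : ℂ) := by
    intro k
    rw [← doubleCoeff_div_ascPochhammer τ w hη hR, ← neg_mul, mul_pow]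
    have : (-Complex.I) ^ doubleDegree R (j, k) = (-Complex.I) ^ (R * j) * (-1) ^ k := by
      rw [doubleDegree, pow_add, pow_mul _ 2, neg_sq, Complex.I_sq]
    rw [this]
    push_cast
    ring
  simp_rw [hterm]
  rw [tsum_mul_left, ← Complex.ofReal_tsum, psiTerm, hphase, mul_left_comm, ← Complex.ofReal_mul]
  congr 2
  rw [besselJ, ← tsum_mul_left, ← tsum_mul_right, ← tsum_mul_left]
  refine tsum_congr fun k => ?_
  have e1 : 2 * η / (2 / R : ℝ) = R * η := by field_simp
  have e2 : (2 * η + 2 / R) / (2 / R : ℝ) = R * η + 1 := by field_simp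
  have e3 : 2 * (η + j) / (2 / R : ℝ) = R * (η + j) := by field_simp
  rw [e1, e2, e3, Real.Gamma_add_one hx.ne']
  have hpow : (w / 2) ^ (2 * (k : ℝ) + R * (η + j)) =
      (w / 2) ^ doubleDegree R (j, k) * (w ^ (R * η) / 2 ^ (R * η)) := by
    rw [← Real.div_rpow hw.le (by norm_num), ← Real.rpow_natCast,
      ← Real.rpow_add (by positivity)]
    congr 1
    simp only [doubleDegree]
    push_cast
    ring
  have p1 : (2 : ℝ) ^ (R * η) ≠ 0 := (Real.rpow_pos_of_pos two_pos _).ne'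
  have p2 : w ^ (R * η) ≠ 0 := (Real.rpow_pos_of_pos hw _).ne'
  have p3 : Real.Gamma (R * (η + j) + k + 1) ≠ 0 := (Real.Gamma_pos_of_pos (by positivity)).ne'
  rw [hpow, Real.rpow_neg hw.le, psiDoubleTerm, add_comm (k : ℝ)]
  field_simp

/-- The double series converges absolutely: summed by rows it is Ψ, summed by degree it is a power
series in -iw. -/
lemma summable_psiTerm_and_hasSum {η τ w : ℝ} {R : ℕ} (hη : 0 < η) (hR : 0 < R) (hτ : |τ| ≤ 1)
    (hw : 0 < w) :
    Summable (psiTerm (2 / R) η w τ) ∧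
      HasSum (fun n : ℕ => (-(Complex.I * w)) ^ n *
        (((∑' p : doubleDegree R ⁻¹' {n}, doubleCoeff η τ R p) /
          (ascPochhammer ℝ n).eval (R * η) : ℝ) : ℂ)) (Psi (2 / R) η w τ) := by
  set D : ℕ × ℕ → ℂ := fun p => (-(Complex.I * w)) ^ doubleDegree R p *
    ((doubleCoeff η τ R p / (ascPochhammer ℝ (doubleDegree R p)).eval (R * η) : ℝ) : ℂ) with hD
  have hsum : Summable D := by
    refine Summable.of_norm ((summable_psiDoubleTerm hη hR hτ hw).abs.congr fun p => ?_)
    rw [← doubleCoeff_div_ascPochhammer τ w hη hR, hD]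
    simp only [norm_mul, norm_pow, norm_neg, Complex.norm_I, one_mul, Complex.norm_real,
      Real.norm_eq_abs, abs_mul, abs_pow]
    ring
  have hrow := hsum.hasSum.prod_fiberwise fun j => (hsum.prod_factor j).hasSum
  simp only [hD, ← Psi_const_mul_psiTerm hη hR hw] at hrow
  have hK : ((2 ^ (2 * η / (2 / R : ℝ)) * Real.Gamma ((2 * η + 2 / R) / (2 / R)) : ℝ) : ℂ) ≠ 0 := by
    have : 0 < Real.Gamma ((2 * η + 2 / R) / (2 / R)) := Real.Gamma_pos_of_pos (by positivity)
    exact Complex.ofReal_ne_zero.2 (by positivity)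
  have hs : Summable (psiTerm (2 / R) η w τ) := (summable_mul_left_iff hK).1 hrow.summable
  refine ⟨hs, ?_⟩
  have hPsi : Psi (2 / R) η w τ = ∑' p, D p := by
    rw [Psi, if_neg hw.ne', ← hs.tsum_mul_left]
    exact hrow.tsum_eq
  rw [hPsi]
  refine Eq.subst (motive := fun g => HasSum g _) (funext fun n => ?_)
    (hsum.hasSum.tsum_fiberwise (doubleDegree R))
  rw [← tsum_div_const, Complex.ofReal_tsum, ← tsum_mul_left]
  refine tsum_congr fun p => ?_
  simp only [hD]
  rw [show doubleDegree R p = n from p.2]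

/-! ### The largest node -/

lemma abs_cos_le_cos {x δ : ℝ} (hδ : 0 ≤ δ) (h1 : δ ≤ x) (h2 : x ≤ Real.pi - δ) :
    |Real.cos x| ≤ Real.cos δ := by
  rw [abs_le]
  refine ⟨?_, Real.cos_le_cos_of_nonneg_of_le_pi hδ (by linarith) h1⟩
  rw [← Real.cos_pi_sub]
  exact Real.cos_le_cos_of_nonneg_of_le_pi (by linarith) (by linarith) h2

lemma abs_cos_node_le {q r : ℝ} {R : ℕ} (hR : 2 ≤ R) (hr0 : 0 ≤ r) (hrq : r ≤ q)
    (hq : q ≤ Real.pi) (hr : Odd R → r ≤ Real.pi - q) (l : ℕ) :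
    |Real.cos ((q + 2 * Real.pi * l) / R)| ≤ Real.cos (r / R) := by
  have hR0 : (0 : ℝ) < R := by positivity
  -- The law is built from an infinite sequence of nodes, so the bound must cover every l.
  have hper : Real.cos ((q + 2 * Real.pi * l) / R) =
      Real.cos ((q + 2 * Real.pi * (l % R : ℕ)) / R) := by
    rw [← Real.cos_add_nat_mul_two_pi ((q + 2 * Real.pi * (l % R : ℕ)) / R) (l / R)]
    congr 1
    have : (l : ℝ) = R * (l / R : ℕ) + (l % R : ℕ) := by exact_mod_cast (Nat.div_add_mod l R).symm
    rw [this]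
    field_simp
    ring
  rw [hper]
  have hlt : l % R < R := Nat.mod_lt _ (by omega)
  generalize l % R = i at hlt
  have hpi := Real.pi_pos
  rcases Nat.lt_or_ge (2 * i) R with h | h
  · refine abs_cos_le_cos (by positivity) ?_ ?_
    · gcongr
      have : 0 ≤ 2 * Real.pi * i := by positivity
      linarith
    · rw [le_sub_iff_add_le, ← add_div, div_le_iff₀ hR0]
      -- Only here does parity matter: for odd R the angle may come within (π - q)/R of π.
      rcases Nat.even_or_odd R with he | ho
      · have h' : 2 * i + 2 ≤ R := by obtain ⟨m, rfl⟩ := he; omega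
        have : (2 : ℝ) * i + 2 ≤ R := by exact_mod_cast h'
        nlinarith
      · have := hr ho
        have : (2 : ℝ) * i + 1 ≤ R := by exact_mod_cast h
        nlinarith
  · rw [← abs_neg, ← Real.cos_sub_pi]
    have h1 : (R : ℝ) ≤ 2 * i := by exact_mod_cast h
    have h2 : (i : ℝ) + 1 ≤ R := by exact_mod_cast hlt
    refine abs_cos_le_cos (by positivity) ?_ ?_
    · rw [le_sub_iff_add_le, div_add' _ _ _ hR0.ne']
      refine div_le_div_of_nonneg_right ?_ hR0.le
      nlinarith
    · rw [le_sub_iff_add_le, sub_add_eq_add_sub, sub_le_iff_le_add, ← add_div, div_le_iff₀ hR0]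
      nlinarith

lemma abs_cos_node_le_thetaType {R : ℕ} (hR : 2 ≤ R) (τ : ℝ) (l : ℕ) :
    |Real.cos ((Real.arccos τ + 2 * Real.pi * l) / R)| ≤ thetaType R τ := by
  have h0 := Real.arccos_nonneg τ
  have h1 := Real.arccos_le_pi τ
  rw [thetaType]
  split_ifs with h
  · exact abs_cos_node_le hR (by linarith) (by linarith [h.2]) h1 (fun _ => le_rfl) l
  · refine abs_cos_node_le hR h0 le_rfl h1 (fun ho => ?_) l
    have : ¬ Real.pi / 2 ≤ Real.arccos τ := fun h2 => h ⟨ho, h2⟩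
    linarith

lemma exists_abs_cos_node_eq_thetaType {R : ℕ} (hR : 2 ≤ R) (τ : ℝ) :
    ∃ l < R, |Real.cos ((Real.arccos τ + 2 * Real.pi * l) / R)| = thetaType R τ := by
  have h0 := Real.arccos_nonneg τ
  have h1 := Real.arccos_le_pi τ
  have hpi := Real.pi_pos
  have hR2 : (2 : ℝ) ≤ R := by exact_mod_cast hR
  have hpos : ∀ x, 0 ≤ x → x ≤ Real.pi → 0 ≤ Real.cos (x / R) := fun x hx hx' => by
    have h2 : x / R ≤ Real.pi / 2 := by gcongr
    exact Real.cos_nonneg_of_neg_pi_div_two_le_of_le (by linarith [div_nonneg hx R.cast_nonneg]) h2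
  rw [thetaType]
  split_ifs with h
  · obtain ⟨m, rfl⟩ := h.1
    -- For R = 2m + 1 the m-th angle is π - (π - q)/R, the closest to π.
    refine ⟨m, by omega, ?_⟩
    have : (Real.arccos τ + 2 * Real.pi * m) / ((2 * m + 1 : ℕ) : ℝ) =
        Real.pi - (Real.pi - Real.arccos τ) / ((2 * m + 1 : ℕ) : ℝ) := by
      push_cast
      field_simp
      ring
    rw [this, Real.cos_pi_sub, abs_neg, abs_of_nonneg (hpos _ (by linarith) (by linarith))]
  · refine ⟨0, by omega, ?_⟩
    rw [Nat.cast_zero, mul_zero, add_zero, abs_of_nonneg (hpos _ h0 h1)]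
end

/-! ### The main theorem -/

theorem mainTheorem4 (d : ℕ) (hd : 1 ≤ d)
    (Ω : Finset (EuclideanSpace ℝ (Fin d))) (hΩ : IsDunklRootSystem Ω)
    (κ : EuclideanSpace ℝ (Fin d) → ℝ) (hκ : IsMultiplicityFunction Ω κ)
    (R : ℕ) (hR : 2 ≤ R) (a : ℝ) (ha : a = 2 / (R : ℝ))
    (η : ℝ) (hη : η = kappaBracket Ω κ + ((d : ℝ) - 2) / 2) (hη0 : 0 < η)
    (τ : ℝ) (hτ : τ ∈ Set.Icc (-1 : ℝ) 1) :
    (∀ w : ℝ, 0 < w → Summable (psiTerm a η w τ)) ∧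
    ∃ F : ℂ → ℂ,
      (∀ w : ℝ, 0 ≤ w → F (w : ℂ) = Psi a η w τ) ∧
      IsPositiveDefiniteFun (fun w : ℝ => F (w : ℂ)) ∧
      IsEntireOfExponentialType F (thetaType R τ) := by
  have hR0 : 0 < R := by omega
  have hτ1 : |τ| ≤ 1 := abs_le.2 hτ
  have hcos : Real.cos (Real.arccos τ) = τ := Real.cos_arccos hτ.1 hτ.2
  subst ha
  obtain ⟨m, rfl⟩ : ∃ m, R = m + 1 := ⟨R - 1, by omega⟩
  obtain ⟨μ, hμ, hμM, hμb, hμm⟩ := exists_dirichlet_law hη0 _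
    (abs_cos_node_le_thetaType hR τ) m
  obtain ⟨l, hl, hlθ⟩ := exists_abs_cos_node_eq_thetaType hR τ
  refine ⟨fun w hw => (summable_psiTerm_and_hasSum hη0 hR0 hτ1 hw).1, fourierStieltjes μ,
    fun w hw => ?_, isPositiveDefiniteFun_fourierStieltjes hμM,
    isEntireOfExponentialType_fourierStieltjes hμM hlθ (hμb l (by omega))⟩
  rcases hw.eq_or_lt with rfl | hw
  · rw [Complex.ofReal_zero, fourierStieltjes_zero, Psi, if_pos rfl]
  -- Both sides are sums of power series in -iw; the moments of μ match the coefficients of Ψ degree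
  -- by degree.
  · refine (hasSum_fourierStieltjes hμM (w : ℂ)).unique ?_
    refine Eq.subst (motive := fun g => HasSum g _) (funext fun n => ?_)
      (summable_psiTerm_and_hasSum hη0 hR0 hτ1 hw).2
    have h := dirichletCoeff_eq_tsum (q := Real.arccos τ) hη0 hR0 n
    rw [hcos] at h
    rw [hμm, ← h]
    have : (n.factorial : ℂ) ≠ 0 := by exact_mod_cast n.factorial_ne_zero
    push_cast
    field_simp
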